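/- A (real, associative, not necessarily unital) algebra $A$ that is also a vector lattice is called an $f$-algebra if $ab\ge 0$ whenever $a,b\ge 0$, and $a\wedge b=0$ implies $(ac)\wedge b=(ca)\wedge b=0$ for all $0\le c\in A$; it is semiprime if $a^2=0$ implies $a=0$. Let $\mathrm{Orth}(A)$ denote the orthomorphisms of $A$, that is, the order bounded linear maps $S:A\to A$ such that $|x|\wedge|y|=0$ implies $|Sx|\wedge |y|=0$, ordered by $S\le R$ iff $Sx\le Rx$ for all $x\ge 0$, and let $I_A\in\mathrm{Orth}(A)$ be the identity. An Archimedean semiprime $f$-algebra $A$ is identified with a subset of $\mathrm{Orth}(A)$ through $a\mapsto\pi_a$, $\pi_a(b)=ab$, so that $A\cap[0,I_A]=\{a\in A: 0\le\pi_a\le I_A\}$. A linear operator $T:A\to B$ between Archimedean semiprime $f$-algebras is contractive if it is positive and $T(a)\in B\cap[0,I_B]$ for all $a\in A\cap[0,I_A]$. A vector lattice $B$ is relatively uniformly complete if for every $0\le u\in B$ and every sequence $(x_n)$ in $B$ that is $u$-uniformly Cauchy (for each $\varepsilon>0$ there is $N$ with $|x_m-x_n|\le\varepsilon u$ for all $m,n\ge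 N$) there is $x\in B$ to which it converges $u$-uniformly (for each $\varepsilon>0$ there is $N$ with $|x_n-x|\le\varepsilon u$ for all $n\ge N$). **Proposition 3.7.** Let $A$ and $B$ be Archimedean semiprime $f$-algebras such that $B$ is relatively uniformly complete, and let $T:A\to B$ be a positive linear operator. Then $T$ is contractive and is an extreme point of the (convex) set of all contractive operators from $A$ to $B$ if and only if $T$ is an algebra homomorphism, i.e. $T(ab)=T(a)T(b)$ for all $a,b\in A$. -/

import Mathlib

/-! Vector lattices (Riesz spaces) are `[AddCommGroup A] [Module ℝ A] [Lattice A]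
[IsOrderedAddMonoid A] [IsOrderedModule ℝ A]`; real (associative, not necessarily unital)
algebras are `[NonUnitalRing A] [Module ℝ A] [IsScalarTower ℝ A A] [SMulCommClass ℝ A A]`. -/

namespace FAlg

/-- A vector lattice is Archimedean if `n a ≤ b` for all `n` (with `a, b ≥ 0`) forces `a = 0`.
(Mathlib's `Archimedean` is a different notion, meant for linear orders.) -/
def IsArchimedean (A : Type*) [AddCommGroup A] [Lattice A] : Prop :=
  ∀ a b : A, 0 ≤ a → 0 ≤ b → (∀ n : ℕ, n • a ≤ b) → a = 0

/-- `x n` is a Cauchy sequence relatively uniformly with respect to the regulator `u`. -/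
def IsRUCauchy {A : Type*} [AddCommGroup A] [Module ℝ A] [Lattice A]
    (u : A) (x : ℕ → A) : Prop :=
  ∀ ε : ℝ, 0 < ε → ∃ N : ℕ, ∀ m ≥ N, ∀ n ≥ N, |x m - x n| ≤ ε • u

/-- `x n` converges to `l` relatively uniformly with respect to the regulator `u`. -/
def RUTendsto {A : Type*} [AddCommGroup A] [Module ℝ A] [Lattice A]
    (u : A) (x : ℕ → A) (l : A) : Prop :=
  ∀ ε : ℝ, 0 < ε → ∃ N : ℕ, ∀ n ≥ N, |x n - l| ≤ ε • u

/-- Relative uniform completeness: for every regulator `u ≥ 0`, every `u`-uniformly Cauchy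
sequence is `u`-uniformly convergent. -/
def IsRUComplete (A : Type*) [AddCommGroup A] [Module ℝ A] [Lattice A] : Prop :=
  ∀ u : A, 0 ≤ u → ∀ x : ℕ → A, IsRUCauchy u x → ∃ l : A, RUTendsto u x l

/-- The lattice-ordered algebra `A` is an `f`-algebra. -/
class IsFAlgebra (A : Type*) [NonUnitalRing A] [Lattice A] : Prop where
  mul_nonneg' : ∀ a b : A, 0 ≤ a → 0 ≤ b → 0 ≤ a * b
  mul_right_inf : ∀ a b c : A, a ⊓ b = 0 → 0 ≤ c → (a * c) ⊓ b = 0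
  mul_left_inf : ∀ a b c : A, a ⊓ b = 0 → 0 ≤ c → (c * a) ⊓ b = 0

/-- Semiprime: zero is the only nilpotent element, i.e. `a² = 0` implies `a = 0`. -/
def IsSemiprime (A : Type*) [NonUnitalRing A] : Prop :=
  ∀ a : A, a * a = 0 → a = 0

/-- An orthomorphism: an order bounded linear operator `S` on `A` such that `x ⊥ y` implies
`S x ⊥ y`. -/
structure IsOrthomorphism {A : Type*} [AddCommGroup A] [Module ℝ A] [Lattice A]
    (S : A →ₗ[ℝ] A) : Prop where
  bddAbove : ∀ u v : A, BddAbove (S '' Set.Icc u v)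
  bddBelow : ∀ u v : A, BddBelow (S '' Set.Icc u v)
  disjoint : ∀ x y : A, |x| ⊓ |y| = 0 → |S x| ⊓ |y| = 0

/-- `Orth A`, the set of orthomorphisms of `A`. -/
def Orth (A : Type*) [AddCommGroup A] [Module ℝ A] [Lattice A] : Type _ :=
  {S : A →ₗ[ℝ] A // IsOrthomorphism S}

namespace Orth

section Order

variable {A : Type*} [AddCommGroup A] [Module ℝ A] [Lattice A] [IsOrderedAddMonoid A]

/-- The operator order on `Orth A`: `S ≤ R` iff `S x ≤ R x` for all `x ≥ 0`. -/
instance : PartialOrder (Orth A) where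
  le S R := ∀ x : A, 0 ≤ x → S.1 x ≤ R.1 x
  le_refl _ _ _ := le_rfl
  le_trans _ _ _ h₁ h₂ x hx := (h₁ x hx).trans (h₂ x hx)
  le_antisymm S R h₁ h₂ := by
    refine Subtype.ext (LinearMap.ext fun x => ?_)
    have key : ∀ y : A, 0 ≤ y → S.1 y = R.1 y := fun y hy => le_antisymm (h₁ y hy) (h₂ y hy)
    rw [← posPart_sub_negPart x, map_sub, map_sub, key _ (posPart_nonneg x),
      key _ (negPart_nonneg x)]

/-- The zero operator. -/
instance : Zero (Orth A) :=
  ⟨⟨0, ⟨fun _ _ => ⟨0, by rintro _ ⟨x, -, rfl⟩; simp⟩,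
    fun _ _ => ⟨0, by rintro _ ⟨x, -, rfl⟩; simp⟩, fun x y _ => by simp⟩⟩⟩

/-- The identity operator `I`. -/
instance : One (Orth A) :=
  ⟨⟨LinearMap.id, ⟨fun u v => ⟨v, by rintro _ ⟨x, hx, rfl⟩; exact hx.2⟩,
    fun u v => ⟨u, by rintro _ ⟨x, hx, rfl⟩; exact hx.1⟩, fun x y h => h⟩⟩⟩

end Order

end Orth

section Mul

variable {A : Type*} [NonUnitalRing A] [Lattice A] [IsOrderedAddMonoid A] [IsFAlgebra A]

theorem mul_le_mul_left_of_nonneg {c x y : A} (hc : 0 ≤ c) (h : x ≤ y) : c * x ≤ c * y := by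
  have := IsFAlgebra.mul_nonneg' c (y - x) hc (sub_nonneg.2 h)
  rwa [mul_sub, sub_nonneg] at this

theorem abs_mul_le_abs_mul_abs (a x : A) : |a * x| ≤ |a| * |x| := by
  have hp := posPart_nonneg a
  have hn := negPart_nonneg a
  have hq := posPart_nonneg x
  have hm := negPart_nonneg x
  have h1 := IsFAlgebra.mul_nonneg' _ _ hp hq
  have h2 := IsFAlgebra.mul_nonneg' _ _ hp hm
  have h3 := IsFAlgebra.mul_nonneg' _ _ hn hq
  have h4 := IsFAlgebra.mul_nonneg' _ _ hn hm
  have e : a * x = (a⁺ - a⁻) * (x⁺ - x⁻) := by rw [posPart_sub_negPart, posPart_sub_negPart]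
  rw [← posPart_add_negPart a, ← posPart_add_negPart x, e]
  refine abs_le'.2 ⟨?_, ?_⟩
  · rw [← sub_nonneg]
    have : (a⁺ + a⁻) * (x⁺ + x⁻) - (a⁺ - a⁻) * (x⁺ - x⁻)
        = a⁺ * x⁻ + a⁺ * x⁻ + (a⁻ * x⁺ + a⁻ * x⁺) := by noncomm_ring
    rw [this]
    exact add_nonneg (add_nonneg h2 h2) (add_nonneg h3 h3)
  · rw [← sub_nonneg]
    have : (a⁺ + a⁻) * (x⁺ + x⁻) - -((a⁺ - a⁻) * (x⁺ - x⁻))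
        = a⁺ * x⁺ + a⁺ * x⁺ + (a⁻ * x⁻ + a⁻ * x⁻) := by noncomm_ring
    rw [this]
    exact add_nonneg (add_nonneg h1 h1) (add_nonneg h4 h4)

variable [Module ℝ A] [SMulCommClass ℝ A A]

theorem isOrthomorphism_mulLeft (a : A) : IsOrthomorphism (LinearMap.mulLeft ℝ a) where
  bddAbove u v := by
    refine ⟨a⁺ * v - a⁻ * u, ?_⟩
    rintro _ ⟨x, hx, rfl⟩
    have e : LinearMap.mulLeft ℝ a x = a⁺ * x - a⁻ * x := by
      rw [← sub_mul, posPart_sub_negPart, LinearMap.mulLeft_apply]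
    rw [e]
    exact sub_le_sub (mul_le_mul_left_of_nonneg (posPart_nonneg a) hx.2)
      (mul_le_mul_left_of_nonneg (negPart_nonneg a) hx.1)
  bddBelow u v := by
    refine ⟨a⁺ * u - a⁻ * v, ?_⟩
    rintro _ ⟨x, hx, rfl⟩
    have e : LinearMap.mulLeft ℝ a x = a⁺ * x - a⁻ * x := by
      rw [← sub_mul, posPart_sub_negPart, LinearMap.mulLeft_apply]
    rw [e]
    exact sub_le_sub (mul_le_mul_left_of_nonneg (posPart_nonneg a) hx.1)
      (mul_le_mul_left_of_nonneg (negPart_nonneg a) hx.2)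
  disjoint x y h := by
    rw [LinearMap.mulLeft_apply]
    refine le_antisymm ?_ (le_inf (abs_nonneg _) (abs_nonneg _))
    calc |a * x| ⊓ |y| ≤ (|a| * |x|) ⊓ |y| := inf_le_inf_right _ (abs_mul_le_abs_mul_abs a x)
      _ = 0 := IsFAlgebra.mul_left_inf _ _ _ h (abs_nonneg a)

/-- The map `π : A → Orth A`, `π a = (b ↦ a b)`, along which `A` is identified with a subset
of `Orth A`. -/
def toOrth (a : A) : Orth A := ⟨LinearMap.mulLeft ℝ a, isOrthomorphism_mulLeft a⟩

end Mul

/-- The contractive operators `A → B`: positive linear operators that map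
`A ∩ [0, I]` into `B ∩ [0, I]`, the order intervals being taken in `Orth A` and `Orth B`. -/
def contractiveOperators (A B : Type*)
    [NonUnitalRing A] [Module ℝ A] [SMulCommClass ℝ A A] [Lattice A]
    [IsOrderedAddMonoid A] [IsFAlgebra A]
    [NonUnitalRing B] [Module ℝ B] [SMulCommClass ℝ B B] [Lattice B]
    [IsOrderedAddMonoid B] [IsFAlgebra B] : Set (A →ₗ[ℝ] B) :=
  {T | (∀ a : A, 0 ≤ a → 0 ≤ T a) ∧
    ∀ a : A, toOrth a ∈ Set.Icc (0 : Orth A) 1 → toOrth (T a) ∈ Set.Icc (0 : Orth B) 1}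

end FAlg

/-!
Write `[0, I]` for `A ∩ [0, I_A]`. In a semiprime `f`-algebra it consists of the `a ≥ 0` with
`a² ≤ a`, and it is large: for `a ≥ 0` the elements `(n a - a²)⁺` are multiples of its members and
differ from `n a` by at most `a²`. Hence positive operators with values in an Archimedean space are
determined by their values on `[0, I]`.

An extreme contractive `T` is multiplicative because, for `a ∈ [0, I]`, the defect
`D x = T (a x) - T a T x` makes both `T + D` and `T - D` contractive, by `(1 - Ta)(1 - Tx) ≥ 0` and
`1 - (1 - a)(1 - x) ∈ [0, I]` respectively.

Conversely, contractive operators satisfy the Schwarz inequality `(S a)² ≤ S (a²)` on `[0, I]`.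
If `T = s S + t R` is multiplicative, then the identity
`s S² + t R² - (s S + t R)² = s t (S - R)²` forces `S = R`. The Schwarz inequality is obtained from
its scalar linearizations `2 r (S a) - r² ≤ S (a²)`: as there is no function calculus to put
`r = S a`, these are averaged over a random walk whose steps have the operator-valued success
probability `S a`.
-/

namespace FAlg

section LatticeOrderedGroup

variable {E : Type*} [AddCommGroup E] [Lattice E] [IsOrderedAddMonoid E]

theorem posPart_sub_of_inf_eq_zero {u v : E} (h : u ⊓ v = 0) : (u - v)⁺ = u := by
  rw [inf_eq_sub_posPart_sub, sub_eq_zero] at h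
  exact h.symm

theorem nsmul_posPart_add_nsmul_le {x u : E} (h : ∀ n : ℕ, n • x ≤ u) (m k : ℕ) :
    m • x⁺ + k • x ≤ u := by
  induction m generalizing k with
  | zero => simpa using h k
  | succ m ih =>
    have hsup : x⁺ + k • x = (k + 1) • x ⊔ k • x := by
      rw [posPart_def, sup_add, zero_add, succ_nsmul']
    rw [succ_nsmul, add_assoc, hsup, add_sup]
    exact sup_le (ih (k + 1)) (ih k)

theorem IsArchimedean.nonpos_of_nsmul_le (hE : IsArchimedean E) {x u : E}
    (h : ∀ n : ℕ, 0 < n → n • x ≤ u) : x ≤ 0 := by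
  have hmul : ∀ n : ℕ, n • x ≤ u⁺ := fun n => by
    rcases n.eq_zero_or_pos with rfl | hn
    · simp
    · exact (h n hn).trans (le_posPart u)
  refine posPart_eq_zero.1 (hE _ u⁺ (posPart_nonneg x) (posPart_nonneg u) fun n => ?_)
  simpa using nsmul_posPart_add_nsmul_le hmul n 0

theorem linearMap_ext_of_nonneg {R F : Type*} [Semiring R] [Module R E] [AddCommGroup F]
    [Module R F] {S T : E →ₗ[R] F} (h : ∀ x, 0 ≤ x → S x = T x) : S = T := by
  ext x
  rw [← posPart_sub_negPart x, map_sub, map_sub, h _ (posPart_nonneg x), h _ (negPart_nonneg x)]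

end LatticeOrderedGroup

section TangentParabola

/-- The bound at `(n, r)` is the average of `2 s Q - s²` over the position `s` of a walk that starts
at `r` and makes `n` independent steps of length `d`, each with probability `Q`. Conditioning on the
first step splits `b` as `(b - Q b) + Q b`. -/
theorem walk_average_le {E : Type*} [AddCommGroup E] [PartialOrder E] [IsOrderedAddMonoid E]
    [Module ℝ E] {P Q : E →ₗ[ℝ] E} (hQ₀ : ∀ b, 0 ≤ b → 0 ≤ Q b) (hQ₁ : ∀ b, 0 ≤ b → Q b ≤ b)
    (hP : ∀ r : ℝ, 0 ≤ r → ∀ b, 0 ≤ b → (2 * r) • Q b - r ^ 2 • b ≤ P b)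
    {d : ℝ} (hd : 0 ≤ d) (n : ℕ) {r : ℝ} (hr : 0 ≤ r) {b : E} (hb : 0 ≤ b) :
    (2 : ℝ) • (r • Q b + (n * d) • Q (Q b)) - (r ^ 2 • b + (2 * r * (n * d)) • Q b +
      (n * d ^ 2) • (Q b - Q (Q b)) + (n * d) ^ 2 • Q (Q b)) ≤ P b := by
  induction n generalizing r b with
  | zero =>
    convert hP r hr b hb using 1
    push_cast
    module
  | succ n ih =>
    have hstay := ih hr (sub_nonneg.2 (hQ₁ b hb))
    have hmove := ih (add_nonneg hr hd) (hQ₀ b hb)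
    convert add_le_add hstay hmove using 1
    · simp only [map_sub]
      push_cast
      module
    · rw [← map_add, sub_add_cancel]

theorem IsArchimedean.apply_apply_le_of_tangent_le {E : Type*} [AddCommGroup E] [Module ℝ E]
    [Lattice E] [IsOrderedAddMonoid E] [IsOrderedModule ℝ E] (hE : IsArchimedean E)
    {P Q : E →ₗ[ℝ] E} (hQ₀ : ∀ b, 0 ≤ b → 0 ≤ Q b) (hQ₁ : ∀ b, 0 ≤ b → Q b ≤ b)
    (hP : ∀ r : ℝ, 0 ≤ r → ∀ b, 0 ≤ b → (2 * r) • Q b - r ^ 2 • b ≤ P b) {b : E} (hb : 0 ≤ b) :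
    Q (Q b) ≤ P b := by
  refine sub_nonpos.1 (hE.nonpos_of_nsmul_le (u := Q b - Q (Q b)) fun n hn => ?_)
  have hn₀ : (n : ℝ) ≠ 0 := Nat.cast_ne_zero.2 hn.ne'
  have hwalk := walk_average_le hQ₀ hQ₁ hP (d := (n : ℝ)⁻¹) (by positivity) n le_rfl hb
  have hscaled := smul_le_smul_of_nonneg_left (sub_nonneg.2 hwalk) n.cast_nonneg (α := ℝ)
  rw [← Nat.cast_smul_eq_nsmul ℝ, ← sub_nonneg]
  rw [smul_zero] at hscaled
  convert hscaled using 1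
  match_scalars <;> field_simp <;> ring

end TangentParabola

section Ring

variable {A : Type*} [NonUnitalRing A]

theorem IsSemiprime.mul_eq_zero_comm (hA : IsSemiprime A) {x y : A} (h : x * y = 0) :
    y * x = 0 := by
  apply hA
  rw [mul_assoc, ← mul_assoc x, h, zero_mul, mul_zero]

variable [Lattice A] [IsFAlgebra A]

theorem mul_eq_zero_of_inf_eq_zero {a b : A} (h : a ⊓ b = 0) : a * b = 0 := by
  have hab : b ⊓ (a * b) = 0 := inf_comm b _ ▸ IsFAlgebra.mul_right_inf a b b h (h ▸ inf_le_right)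
  simpa using IsFAlgebra.mul_left_inf b (a * b) a hab (h ▸ inf_le_left)

variable [IsOrderedAddMonoid A]

instance : PosMulMono A := ⟨fun _ hc _ _ h => mul_le_mul_left_of_nonneg hc h⟩

instance : MulPosMono A where
  mul_le_mul_of_nonneg_right c hc x y h := by
    have := IsFAlgebra.mul_nonneg' (y - x) c (sub_nonneg.2 h) hc
    rwa [sub_mul, sub_nonneg] at this

theorem mul_posPart {c : A} (hc : 0 ≤ c) (x : A) : c * x⁺ = (c * x)⁺ := by
  have h₁ := IsFAlgebra.mul_left_inf _ _ c (posPart_inf_negPart_eq_zero x) hc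
  rw [inf_comm] at h₁
  have h₂ := IsFAlgebra.mul_left_inf _ _ c h₁ hc
  rw [inf_comm] at h₂
  rw [← posPart_sub_of_inf_eq_zero h₂, ← mul_sub, posPart_sub_negPart]

theorem posPart_mul {c : A} (hc : 0 ≤ c) (x : A) : x⁺ * c = (x * c)⁺ := by
  have h₁ := IsFAlgebra.mul_right_inf _ _ c (posPart_inf_negPart_eq_zero x) hc
  rw [inf_comm] at h₁
  have h₂ := IsFAlgebra.mul_right_inf _ _ c h₁ hc
  rw [inf_comm] at h₂
  rw [← posPart_sub_of_inf_eq_zero h₂, ← sub_mul, posPart_sub_negPart]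

theorem posPart_mul_negPart (x : A) : x⁺ * x⁻ = 0 :=
  mul_eq_zero_of_inf_eq_zero (posPart_inf_negPart_eq_zero x)

theorem negPart_mul_posPart (x : A) : x⁻ * x⁺ = 0 :=
  mul_eq_zero_of_inf_eq_zero (inf_comm x⁺ x⁻ ▸ posPart_inf_negPart_eq_zero x)

theorem mul_posPart_self (x : A) : x * x⁺ = x⁺ * x⁺ := by
  nth_rw 1 [← posPart_sub_negPart x]
  rw [sub_mul, negPart_mul_posPart, sub_zero]

theorem posPart_mul_self (x : A) : x⁺ * x = x⁺ * x⁺ := by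
  nth_rw 2 [← posPart_sub_negPart x]
  rw [mul_sub, posPart_mul_negPart, sub_zero]

theorem mul_negPart_self (x : A) : x * x⁻ = -(x⁻ * x⁻) := by
  nth_rw 1 [← posPart_sub_negPart x]
  rw [sub_mul, posPart_mul_negPart, zero_sub]

protected theorem mul_self_nonneg (x : A) : 0 ≤ x * x := by
  have hx : x * x = x⁺ * x⁺ + x⁻ * x⁻ := by
    nth_rw 2 [← posPart_sub_negPart x]
    rw [mul_sub, mul_posPart_self, mul_negPart_self, sub_neg_eq_add]
  rw [hx]
  exact add_nonneg (mul_nonneg (posPart_nonneg x) (posPart_nonneg x))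
    (mul_nonneg (negPart_nonneg x) (negPart_nonneg x))

namespace IsSemiprime

variable (hA : IsSemiprime A)
include hA

theorem eq_zero_of_mul_self_nonpos {x : A} (h : x * x ≤ 0) : x = 0 :=
  hA x (h.antisymm (FAlg.mul_self_nonneg x))

theorem nonpos_of_mul_nonpos {x : A} (h : ∀ b : A, 0 ≤ b → x * b ≤ 0) : x ≤ 0 := by
  have hx := h _ (posPart_nonneg x)
  rw [mul_posPart_self] at hx
  exact posPart_eq_zero.1 (hA.eq_zero_of_mul_self_nonpos hx)

theorem nonneg_of_mul_nonneg {z f : A} (hf : 0 ≤ f) (hzf : 0 ≤ z * f)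
    (hann : ∀ w, f * w = 0 → z * w = 0) : 0 ≤ z := by
  have hzf' : z⁻ * f = 0 := by
    rw [← posPart_neg, posPart_mul hf, posPart_eq_zero, neg_mul]
    exact neg_nonpos.2 hzf
  have hzz : z * z⁻ = 0 := hann _ (hA.mul_eq_zero_comm hzf')
  rw [mul_negPart_self, neg_eq_zero] at hzz
  exact negPart_eq_zero.1 (hA _ hzz)

theorem mul_le_of_mul_self_le {c b : A} (hc : 0 ≤ c) (hcc : c * c ≤ c) (hb : 0 ≤ b) :
    c * b ≤ b := by
  set d := (c * b - b)⁺ with hd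
  have hd₀ : 0 ≤ d := posPart_nonneg _
  have hcd : c * d = 0 := by
    rw [hd, mul_posPart hc, posPart_eq_zero, mul_sub, ← mul_assoc]
    exact sub_nonpos.2 (mul_le_mul_of_nonneg_right hcc hb)
  have hdd : d * d ≤ 0 := by
    rw [hd, ← posPart_mul_self, ← hd, mul_sub, ← mul_assoc, hA.mul_eq_zero_comm hcd, zero_mul,
      zero_sub]
    exact neg_nonpos.2 (mul_nonneg hd₀ hb)
  exact sub_nonpos.1 (posPart_eq_zero.1 (hA.eq_zero_of_mul_self_nonpos hdd))

end IsSemiprime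

end Ring

theorem IsSemiprime.eq_of_smul_mul_self_add_le {A : Type*} [NonUnitalRing A] [Module ℝ A]
    [IsScalarTower ℝ A A] [SMulCommClass ℝ A A] [Lattice A] [IsOrderedAddMonoid A]
    [IsOrderedModule ℝ A] [IsFAlgebra A] (hA : IsSemiprime A) {x y : A} {s t : ℝ} (hs : 0 < s)
    (ht : 0 < t) (hst : s + t = 1)
    (h : s • (x * x) + t • (y * y) ≤ (s • x + t • y) * (s • x + t • y)) : x = y := by
  have hvar : s • (x * x) + t • (y * y) - (s • x + t • y) * (s • x + t • y) =
      (s * t) • ((x - y) * (x - y)) := by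
    obtain rfl : t = 1 - s := by linarith
    simp only [mul_add, add_mul, mul_sub, sub_mul, smul_mul_assoc, mul_smul_comm]
    module
  have hst₀ : 0 < s * t := mul_pos hs ht
  rw [← sub_nonpos, hvar] at h
  exact sub_eq_zero.1 (hA.eq_zero_of_mul_self_nonpos
    (nonpos_of_smul_nonpos_of_pos_left h hst₀))

section Subidentities

/-- The set `A ∩ [0, I_A]`, written without reference to `Orth A`. It agrees with the definition by
means of `toOrth` when `A` is semiprime, see `IsSemiprime.toOrth_mem_Icc_iff`. -/
def subidentities (A : Type*) [NonUnitalRing A] [Lattice A] : Set A :=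
  {a | 0 ≤ a ∧ ∀ b, 0 ≤ b → a * b ≤ b}

variable {A : Type*} [NonUnitalRing A] [Lattice A] [IsOrderedAddMonoid A] [IsFAlgebra A]

theorem IsSemiprime.toOrth_mem_Icc_iff [Module ℝ A] [SMulCommClass ℝ A A] (hA : IsSemiprime A)
    {a : A} : toOrth a ∈ Set.Icc (0 : Orth A) 1 ↔ a ∈ subidentities A := by
  refine and_congr_left' ⟨fun h => ?_, fun h b hb => mul_nonneg h hb⟩
  refine neg_nonpos.1 (hA.nonpos_of_mul_nonpos fun b hb => ?_)
  rw [neg_mul, neg_nonpos]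
  exact h b hb

theorem IsSemiprime.mem_subidentities_iff (hA : IsSemiprime A) {a : A} :
    a ∈ subidentities A ↔ 0 ≤ a ∧ a * a ≤ a :=
  ⟨fun h => ⟨h.1, h.2 a h.1⟩, fun h => ⟨h.1, fun _ hb => hA.mul_le_of_mul_self_le h.1 h.2 hb⟩⟩

theorem IsSemiprime.mul_le_of_mem_subidentities (hA : IsSemiprime A) {a x : A} (ha : 0 ≤ a)
    (hx : x ∈ subidentities A) : a * x ≤ a := by
  refine sub_nonpos.1 (hA.nonpos_of_mul_nonpos fun b hb => ?_)
  rw [sub_mul, sub_nonpos, mul_assoc]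
  exact mul_le_mul_of_nonneg_left (hx.2 b hb) ha

theorem IsSemiprime.add_sub_mul_mem_subidentities (hA : IsSemiprime A) {a x : A}
    (ha : a ∈ subidentities A) (hx : x ∈ subidentities A) : x + a - a * x ∈ subidentities A := by
  refine ⟨?_, fun b hb => ?_⟩
  · rw [add_sub_assoc]
    exact add_nonneg hx.1 (sub_nonneg.2 (hA.mul_le_of_mem_subidentities ha.1 hx))
  · have h := sub_nonneg.2 (ha.2 _ (sub_nonneg.2 (hx.2 b hb)))
    rw [← sub_nonneg]
    convert h using 1
    noncomm_ring

end Subidentities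

section Truncation

variable {A : Type*} [NonUnitalRing A] [Module ℝ A] [Lattice A]

/-- The positive part of `2 r a - a²`. It lies below `r²` since `(a - r)² ≥ 0`, and for large `r` it
is close to `2 r a`. -/
def truncation (r : ℝ) (a : A) : A := ((2 * r) • a - a * a)⁺

theorem truncation_nonneg (r : ℝ) (a : A) : 0 ≤ truncation r a := posPart_nonneg _

theorem sub_le_truncation (r : ℝ) (a : A) : (2 * r) • a - a * a ≤ truncation r a := le_posPart _

variable [IsOrderedAddMonoid A] [IsFAlgebra A]

theorem truncation_le [IsOrderedModule ℝ A] {r : ℝ} (hr : 0 ≤ r) {a : A} (ha : 0 ≤ a) :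
    truncation r a ≤ (2 * r) • a :=
  sup_le (sub_le_self _ (FAlg.mul_self_nonneg a)) (smul_nonneg (by positivity) ha)

variable [IsScalarTower ℝ A A] [SMulCommClass ℝ A A]

theorem truncation_commute {a : A} (ha : 0 ≤ a) (r : ℝ) : Commute (truncation r a) a := by
  have hcomm : ((2 * r) • a - a * a) * a = a * ((2 * r) • a - a * a) := by
    rw [mul_sub, sub_mul, mul_smul_comm, smul_mul_assoc, mul_assoc]
  rw [Commute, SemiconjBy, truncation, posPart_mul ha, mul_posPart ha, hcomm]

theorem IsSemiprime.truncation_mul_self_le (hA : IsSemiprime A) {a : A} (ha : 0 ≤ a) (r : ℝ) :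
    truncation r a * truncation r a ≤ r ^ 2 • truncation r a := by
  set g := truncation r a with hg
  have hcomm : ∀ y, g * (a * y) = a * (g * y) := (truncation_commute ha r).left_comm
  -- the difference is `(r - a)² g`
  have hz : r ^ 2 • g - g * g = r ^ 2 • g - (2 * r) • (a * g) + a * (a * g) := by
    rw [hg, truncation, ← mul_posPart_self, sub_mul, smul_mul_assoc, mul_assoc]
    abel
  have hsq : (r ^ 2 • g - g * g) * g = (r • g - a * g) * (r • g - a * g) := by
    rw [hz]
    simp only [sub_mul, mul_sub, add_mul, smul_mul_assoc, mul_smul_comm, mul_assoc, hcomm]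
    module
  refine sub_nonneg.1 (hA.nonneg_of_mul_nonneg (truncation_nonneg r a) ?_ fun w hw => ?_)
  · exact hsq ▸ FAlg.mul_self_nonneg _
  · rw [sub_mul, smul_mul_assoc, mul_assoc, hw, mul_zero, smul_zero, sub_zero]

theorem IsSemiprime.inv_smul_truncation_mem [IsOrderedModule ℝ A] (hA : IsSemiprime A) {a : A}
    (ha : 0 ≤ a) {r : ℝ} (hr : 0 < r) : (r ^ 2)⁻¹ • truncation r a ∈ subidentities A := by
  have hr₂ : 0 < r ^ 2 := by positivity
  refine hA.mem_subidentities_iff.2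
    ⟨smul_nonneg (inv_nonneg.2 hr₂.le) (truncation_nonneg r a), ?_⟩
  rw [smul_mul_assoc, mul_smul_comm]
  refine smul_le_smul_of_nonneg_left ?_ (inv_nonneg.2 hr₂.le)
  exact (inv_smul_le_iff_of_pos hr₂).2 (hA.truncation_mul_self_le ha r)

end Truncation

section PositiveOperators

variable {A : Type*} [NonUnitalRing A] [Module ℝ A] [SMulCommClass ℝ A A] [IsScalarTower ℝ A A]
  [Lattice A] [IsOrderedAddMonoid A] [IsOrderedModule ℝ A] [IsFAlgebra A]
  {E : Type*} [AddCommGroup E] [Module ℝ E] [Lattice E] [IsOrderedAddMonoid E]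

theorem IsSemiprime.le_of_eqOn_subidentities (hA : IsSemiprime A) (hE : IsArchimedean E)
    {S R : A →ₗ[ℝ] E} (hS : ∀ a, 0 ≤ a → 0 ≤ S a) (hR : ∀ a, 0 ≤ a → 0 ≤ R a)
    (h : Set.EqOn S R (subidentities A)) {a : A} (ha : 0 ≤ a) : S a ≤ R a := by
  refine sub_nonpos.1 (hE.nonpos_of_nsmul_le (u := S (a * a)) fun n hn => ?_)
  have hr : (0 : ℝ) < n / 2 := by positivity
  set f := truncation (n / 2 : ℝ) a
  have hna : (2 * (n / 2 : ℝ)) • a = n • a := by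
    rw [mul_div_cancel₀ _ two_ne_zero, Nat.cast_smul_eq_nsmul]
  have hSf : S f = R f := by
    have heq := h (hA.inv_smul_truncation_mem ha hr)
    rw [map_smul, map_smul] at heq
    exact smul_right_injective E (inv_ne_zero (by positivity)) heq
  have hle : n • a - f ≤ a * a := sub_le_comm.1 (hna ▸ sub_le_truncation _ a)
  have hge : 0 ≤ n • a - f := sub_nonneg.2 (hna ▸ truncation_le hr.le ha)
  calc n • (S a - R a) = S (n • a - f) - R (n • a - f) := by
        rw [map_sub, map_sub, map_nsmul, map_nsmul, hSf, nsmul_sub]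
        abel
    _ ≤ S (n • a - f) := sub_le_self _ (hR _ hge)
    _ ≤ S (a * a) := by
        rw [← sub_nonneg, ← map_sub]
        exact hS _ (sub_nonneg.2 hle)

theorem IsSemiprime.eq_of_eqOn_subidentities (hA : IsSemiprime A) (hE : IsArchimedean E)
    {S R : A →ₗ[ℝ] E} (hS : ∀ a, 0 ≤ a → 0 ≤ S a) (hR : ∀ a, 0 ≤ a → 0 ≤ R a)
    (h : Set.EqOn S R (subidentities A)) : S = R :=
  linearMap_ext_of_nonneg fun _ ha =>
    (hA.le_of_eqOn_subidentities hE hS hR h ha).antisymm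
      (hA.le_of_eqOn_subidentities hE hR hS h.symm ha)

end PositiveOperators

section MulDefect

variable {A B : Type*} [NonUnitalRing A] [Module ℝ A] [SMulCommClass ℝ A A]
  [NonUnitalRing B] [Module ℝ B] [SMulCommClass ℝ B B]

/-- The map `x ↦ T (a x) - T a T x`, measuring the failure of `T` to be multiplicative at `a`. -/
def mulDefect (T : A →ₗ[ℝ] B) (a : A) : A →ₗ[ℝ] B :=
  T ∘ₗ LinearMap.mulLeft ℝ a - LinearMap.mulLeft ℝ (T a) ∘ₗ T

theorem mulDefect_apply (T : A →ₗ[ℝ] B) (a x : A) : mulDefect T a x = T (a * x) - T a * T x := rfl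

end MulDefect

section ContractiveOperators

variable {A : Type*} [NonUnitalRing A] [Module ℝ A] [SMulCommClass ℝ A A]
  [Lattice A] [IsOrderedAddMonoid A] [IsFAlgebra A]
  {B : Type*} [NonUnitalRing B] [Module ℝ B] [SMulCommClass ℝ B B]
  [Lattice B] [IsOrderedAddMonoid B] [IsFAlgebra B]

theorem mem_contractiveOperators_iff (hA : IsSemiprime A) (hB : IsSemiprime B) {T : A →ₗ[ℝ] B} :
    T ∈ contractiveOperators A B ↔
      (∀ a, 0 ≤ a → 0 ≤ T a) ∧ Set.MapsTo T (subidentities A) (subidentities B) := by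
  simp only [contractiveOperators, Set.mem_ofPred_eq, hA.toOrth_mem_Icc_iff, hB.toOrth_mem_Icc_iff,
    Set.MapsTo]

theorem mem_contractiveOperators_of_map_mul (hA : IsSemiprime A) (hB : IsSemiprime B)
    {T : A →ₗ[ℝ] B} (hT : ∀ a, 0 ≤ a → 0 ≤ T a) (h : ∀ a b, T (a * b) = T a * T b) :
    T ∈ contractiveOperators A B := by
  refine (mem_contractiveOperators_iff hA hB).2
    ⟨hT, fun a ha => hB.mem_subidentities_iff.2 ⟨hT a ha.1, ?_⟩⟩
  rw [← h, ← sub_nonneg, ← map_sub]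
  exact hT _ (sub_nonneg.2 (ha.2 a ha.1))

theorem add_mulDefect_mem_contractiveOperators (hA : IsSemiprime A) (hB : IsSemiprime B)
    {T : A →ₗ[ℝ] B} (hT : T ∈ contractiveOperators A B) {a : A} (ha : a ∈ subidentities A) :
    T + mulDefect T a ∈ contractiveOperators A B := by
  rw [mem_contractiveOperators_iff hA hB] at hT ⊢
  have hpos : ∀ x, 0 ≤ x → 0 ≤ (T + mulDefect T a) x := fun x hx => by
    rw [LinearMap.add_apply, mulDefect_apply, add_sub, add_sub_right_comm]
    exact add_nonneg (sub_nonneg.2 ((hT.2 ha).2 _ (hT.1 x hx))) (hT.1 _ (mul_nonneg ha.1 hx))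
  refine ⟨hpos, fun x hx => ⟨hpos x hx.1, fun b hb => ?_⟩⟩
  have hTax : 0 ≤ T a - T (a * x) := by
    rw [← map_sub]
    exact hT.1 _ (sub_nonneg.2 (hA.mul_le_of_mem_subidentities ha.1 hx))
  have hTa : 0 ≤ (b - T x * b) - T a * (b - T x * b) :=
    sub_nonneg.2 ((hT.2 ha).2 _ (sub_nonneg.2 ((hT.2 hx).2 b hb)))
  rw [LinearMap.add_apply, mulDefect_apply, ← sub_nonneg]
  convert add_nonneg hTa (mul_nonneg hTax hb) using 1
  noncomm_ring

theorem sub_mulDefect_mem_contractiveOperators (hA : IsSemiprime A) (hB : IsSemiprime B)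
    {T : A →ₗ[ℝ] B} (hT : T ∈ contractiveOperators A B) {a : A} (ha : a ∈ subidentities A) :
    T - mulDefect T a ∈ contractiveOperators A B := by
  rw [mem_contractiveOperators_iff hA hB] at hT ⊢
  have hpos : ∀ x, 0 ≤ x → 0 ≤ (T - mulDefect T a) x := fun x hx => by
    rw [LinearMap.sub_apply, mulDefect_apply, ← sub_add, ← map_sub]
    exact add_nonneg (hT.1 _ (sub_nonneg.2 (ha.2 x hx)))
      (mul_nonneg (hT.2 ha).1 (hT.1 x hx))
  refine ⟨hpos, fun x hx => ⟨hpos x hx.1, fun b hb => ?_⟩⟩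
  have hjoin : 0 ≤ b - T (x + a - a * x) * b :=
    sub_nonneg.2 ((hT.2 (hA.add_sub_mul_mem_subidentities ha hx)).2 b hb)
  have hprod : 0 ≤ T a * (b - T x * b) :=
    mul_nonneg (hT.2 ha).1 (sub_nonneg.2 ((hT.2 hx).2 b hb))
  rw [map_sub, map_add] at hjoin
  rw [LinearMap.sub_apply, mulDefect_apply, ← sub_nonneg]
  convert add_nonneg hjoin hprod using 1
  noncomm_ring

theorem mulDefect_eq_zero_of_mem_extremePoints (hA : IsSemiprime A) (hB : IsSemiprime B)
    {T : A →ₗ[ℝ] B} (hT : T ∈ (contractiveOperators A B).extremePoints ℝ) {a : A}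
    (ha : a ∈ subidentities A) : mulDefect T a = 0 := by
  have hmid : T ∈ openSegment ℝ (T + mulDefect T a) (T - mulDefect T a) := by
    refine ⟨1 / 2, 1 / 2, by norm_num, by norm_num, by norm_num, ?_⟩
    module
  simpa using hT.2 (add_mulDefect_mem_contractiveOperators hA hB hT.1 ha)
    (sub_mulDefect_mem_contractiveOperators hA hB hT.1 ha) hmid

variable [IsScalarTower ℝ A A] [IsOrderedModule ℝ A] [IsScalarTower ℝ B B]

theorem map_mul_of_mem_extremePoints (hA : IsSemiprime A) (hB : IsArchimedean B)
    (hB' : IsSemiprime B) {T : A →ₗ[ℝ] B} (hT : T ∈ (contractiveOperators A B).extremePoints ℝ)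
    (a x : A) : T (a * x) = T a * T x := by
  have hTpos : ∀ a, 0 ≤ a → 0 ≤ T a := hT.1.1
  have hright : ∀ x, 0 ≤ x →
      T ∘ₗ LinearMap.mulRight ℝ x = LinearMap.mulRight ℝ (T x) ∘ₗ T := fun x hx =>
    hA.eq_of_eqOn_subidentities hB (fun a ha => hTpos _ (mul_nonneg ha hx))
      (fun a ha => mul_nonneg (hTpos a ha) (hTpos x hx)) fun a ha => sub_eq_zero.1
        (LinearMap.congr_fun (mulDefect_eq_zero_of_mem_extremePoints hA hB' hT ha) x)
  have hleft : T ∘ₗ LinearMap.mulLeft ℝ a = LinearMap.mulLeft ℝ (T a) ∘ₗ T :=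
    linearMap_ext_of_nonneg fun x hx => LinearMap.congr_fun (hright x hx) a
  exact LinearMap.congr_fun hleft x

variable [IsOrderedModule ℝ B]

theorem map_tangent_le (hA : IsSemiprime A) (hB : IsSemiprime B) {S : A →ₗ[ℝ] B}
    (hS : S ∈ contractiveOperators A B) {a : A} (ha : 0 ≤ a) {r : ℝ} (hr : 0 ≤ r) {b : B}
    (hb : 0 ≤ b) : (2 * r) • (S a * b) - r ^ 2 • b ≤ S (a * a) * b := by
  rw [mem_contractiveOperators_iff hA hB] at hS
  rcases hr.eq_or_lt with rfl | hr
  · simpa using mul_nonneg (hS.1 _ (FAlg.mul_self_nonneg a)) hb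
  have htrunc : S (truncation r a) * b ≤ r ^ 2 • b := by
    have h := (hS.2 (hA.inv_smul_truncation_mem ha hr)).2 b hb
    rwa [map_smul, smul_mul_assoc, inv_smul_le_iff_of_pos (by positivity)] at h
  have hmono : (2 * r) • S a - S (a * a) ≤ S (truncation r a) := by
    rw [← map_smul, ← map_sub, ← sub_nonneg, ← map_sub]
    exact hS.1 _ (sub_nonneg.2 (sub_le_truncation r a))
  have h := (mul_le_mul_of_nonneg_right hmono hb).trans htrunc
  rw [sub_mul, smul_mul_assoc] at h
  exact sub_le_comm.1 h

theorem map_mul_map_le_map_mul_self (hA : IsSemiprime A) (hB : IsArchimedean B)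
    (hB' : IsSemiprime B) {S : A →ₗ[ℝ] B} (hS : S ∈ contractiveOperators A B) {a : A}
    (ha : a ∈ subidentities A) : S a * S a ≤ S (a * a) := by
  have hSa : S a ∈ subidentities B := ((mem_contractiveOperators_iff hA hB').1 hS).2 ha
  refine sub_nonpos.1 (hB'.nonpos_of_mul_nonpos fun b hb => ?_)
  rw [sub_mul, sub_nonpos, mul_assoc]
  exact hB.apply_apply_le_of_tangent_le (P := LinearMap.mulLeft ℝ (S (a * a)))
    (Q := LinearMap.mulLeft ℝ (S a)) (fun _ hb => mul_nonneg hSa.1 hb) hSa.2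
    (fun _ hr _ hb => map_tangent_le hA hB' hS ha.1 hr hb) hb

theorem mem_extremePoints_of_map_mul (hA : IsSemiprime A) (hB : IsArchimedean B)
    (hB' : IsSemiprime B) {T : A →ₗ[ℝ] B} (hT : ∀ a, 0 ≤ a → 0 ≤ T a)
    (h : ∀ a b, T (a * b) = T a * T b) : T ∈ (contractiveOperators A B).extremePoints ℝ := by
  refine ⟨mem_contractiveOperators_of_map_mul hA hB' hT h, ?_⟩
  rintro S hS R hR ⟨s, t, hs, ht, hst, rfl⟩
  have hSR : S = R := by
    refine hA.eq_of_eqOn_subidentities hB hS.1 hR.1 fun a ha =>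
      hB'.eq_of_smul_mul_self_add_le hs ht hst ?_
    calc s • (S a * S a) + t • (R a * R a) ≤ s • S (a * a) + t • R (a * a) :=
          add_le_add
            (smul_le_smul_of_nonneg_left (map_mul_map_le_map_mul_self hA hB hB' hS ha) hs.le)
            (smul_le_smul_of_nonneg_left (map_mul_map_le_map_mul_self hA hB hB' hR ha) ht.le)
      _ = (s • S a + t • R a) * (s • S a + t • R a) := h a a
  rw [← hSR, Convex.combo_self hst]

end ContractiveOperators

end FAlg

theorem proposition3p7_general
    {A B : Type*}
    [NonUnitalRing A] [Module ℝ A] [IsScalarTower ℝ A A] [SMulCommClass ℝ A A]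
    [Lattice A] [IsOrderedAddMonoid A] [IsOrderedModule ℝ A] [FAlg.IsFAlgebra A]
    [NonUnitalRing B] [Module ℝ B] [IsScalarTower ℝ B B] [SMulCommClass ℝ B B]
    [Lattice B] [IsOrderedAddMonoid B] [IsOrderedModule ℝ B] [FAlg.IsFAlgebra B]
    (hA : FAlg.IsSemiprime A) (hB : FAlg.IsArchimedean B) (hB' : FAlg.IsSemiprime B)
    (T : A →ₗ[ℝ] B) (hT : ∀ a : A, 0 ≤ a → 0 ≤ T a) :
    (T ∈ FAlg.contractiveOperators A B ∧
      T ∈ (FAlg.contractiveOperators A B).extremePoints ℝ) ↔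
    ∀ a b : A, T (a * b) = T a * T b :=
  ⟨fun h => FAlg.map_mul_of_mem_extremePoints hA hB hB' h.2,
    fun h => ⟨FAlg.mem_contractiveOperators_of_map_mul hA hB' hT h,
      FAlg.mem_extremePoints_of_map_mul hA hB hB' hT h⟩⟩

theorem proposition3p7
    {A B : Type*}
    [NonUnitalRing A] [Module ℝ A] [IsScalarTower ℝ A A] [SMulCommClass ℝ A A]
    [Lattice A] [IsOrderedAddMonoid A] [IsOrderedModule ℝ A] [FAlg.IsFAlgebra A]
    [NonUnitalRing B] [Module ℝ B] [IsScalarTower ℝ B B] [SMulCommClass ℝ B B]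
    [Lattice B] [IsOrderedAddMonoid B] [IsOrderedModule ℝ B] [FAlg.IsFAlgebra B]
    (hA : FAlg.IsArchimedean A) (hA' : FAlg.IsSemiprime A)
    (hB : FAlg.IsArchimedean B) (hB' : FAlg.IsSemiprime B)
    (hBc : FAlg.IsRUComplete B)
    (T : A →ₗ[ℝ] B) (hT : ∀ a : A, 0 ≤ a → 0 ≤ T a) :
    (T ∈ FAlg.contractiveOperators A B ∧
      T ∈ (FAlg.contractiveOperators A B).extremePoints ℝ) ↔
    ∀ a b : A, T (a * b) = T a * T b :=
  proposition3p7_general hA' hB hB' T hT
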